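/- **Setting.** Let $\Omega\subset\mathbb R^2$ be a bounded connected open polygonal set (its boundary is a finite union of segments and $\Omega=\operatorname{int}\overline\Omega$), with $\partial\Omega=\Gamma^D\sqcup\Gamma^N$ (either part may be empty). Let $V\in C^1(\overline\Omega)$, let $u_0\in L^2(\Omega)$ with $u_0\ge 0$ a.e., let $u^D>0$ be given on $\Gamma^D$, and let $\Delta t>0$. Let $(\mathcal T,\mathcal E,(x_K)_{K\in\mathcal T})$ be a finite admissible mesh of $\Omega$: the control volumes $K\in\mathcal T$ are pairwise disjoint open convex polygons contained in $\Omega$ whose union has closure $\overline\Omega$; the edges $\sigma\in\mathcal E$ are pairwise disjoint, nondegenerate, relatively open segments; each $\partial K$ is the union of the $\overline\sigma$, $\sigma\in\mathcal E_K\subset\mathcal E$, and $\mathcal E=\bigcup_K\mathcal E_K$; for $K\ne L$, either $\overline K\cap\overline L$ has zero length, or $\overline K\cap\overline L=\overline\sigma$ for some $\sigma\in\mathcal E_K\cap\mathcal E_L$ (written $\sigma=K|L$); $x_K\in K$; if $\sigma=K|L$ then the line $x_Kx_L$ is orthogonal to $\sigma$; if $\sigma\in\mathcal E_K$ and $\sigma\subset\partial\Omega$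 then the orthogonal projection of $x_K$ on the line containing $\sigma$ lies in $\overline\sigma$; every edge $\sigma\subset\partial\Omega$ is contained in $\Gamma^D$ or in $\Gamma^N$. Denote by $d(x_K,\sigma)$ the distance from $x_K$ to the line containing $\sigma$, by $m_K$ the area of $K$, by $m_\sigma$ the length of $\sigma$, by $x_\sigma$ the midpoint of $\sigma$, and set $d_\sigma=|x_K-x_L|$ if $\sigma=K|L$, $d_\sigma=d(x_K,\sigma)$ if $\sigma\in\mathcal E_K$ is a boundary edge, and $\tau_\sigma=m_\sigma/d_\sigma$. The mesh is assumed regular: for some $\zeta>0$, $d(x_K,\sigma)\ge\zeta d_\sigma$ for all $K$ and $\sigma\in\mathcal E_K$. Let $\mathcal E^D$ be the set of edges contained in $\Gamma^D$, and set $V_K=V(x_K)$, $V_\sigma=V(x_\sigma)$, $u^D_\sigma=u^D(x_\sigma)$. Let $r:(0,\infty)^2\to(0,\infty)$ be nondecreasing in each variable, symmetric, with $r(x,x)=x$, $r(\lambda x,\lambda y)=\lambda r(x,y)$ for $\lambda>0$, and $\frac{x-y}{\log x-\log y}\le r(x,y)\le\max(x,y)$ for $x\neq y$. **Scheme.** A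 solution is a sequence $(u^n)_{n\ge0}$, $u^n=((u^n_K)_{K\in\mathcal T},(u^n_\sigma)_{\sigma\in\mathcal E^D})$, with $u_K^n>0$, $u^0_K=\frac1{m_K}\int_K u_0\,dx$, $u^{n+1}_\sigma=u^D_\sigma$ for $\sigma\in\mathcal E^D$, and, for all $n\ge0$ and $K\in\mathcal T$, $$m_K\frac{u_K^{n+1}-u_K^n}{\Delta t}+\sum_{\sigma\in\mathcal E_K}F^{n+1}_{K,\sigma}=0,$$ where $$F^{n+1}_{K,\sigma}=\begin{cases}-\tau_\sigma\, r(u_K^{n+1},u_L^{n+1})\,\big(\log u_L^{n+1}+V_L-\log u_K^{n+1}-V_K\big)&\text{if }\sigma=K|L,\\ -\tau_\sigma\, r(u_K^{n+1},u_\sigma^{D})\,\big(\log u_\sigma^{D}+V_\sigma-\log u_K^{n+1}-V_K\big)&\text{if }\sigma\in\mathcal E^D,\\ 0&\text{if }\sigma\text{ is a boundary edge contained in }\Gamma^N.\end{cases}$$ **Proposition.** Assume that either $\mathcal E^D=\emptyset$, or $\mathcal E^D\ne\emptyset$ and there is a constant $\alpha^D$ with $\log u^D_\sigma+V_\sigma=\alpha^D$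 for all $\sigma\in\mathcal E^D$. Assume that there is $m_0>0$ with $u^0_K\ge m_0$ for all $K\in\mathcal T$. Put $u_K^\infty=\rho e^{-V_K}$ with $\rho=e^{\alpha^D}$ if $\mathcal E^D\neq\emptyset$, and $\rho=\big(\int_\Omega u_0\,dx\big)\big(\sum_{K\in\mathcal T} m_Ke^{-V_K}\big)^{-1}$ if $\mathcal E^D=\emptyset$. Then the scheme has a solution $(u^n)_{n\ge0}$ such that, for all constants $m^\infty,M^\infty>0$ with $m^\infty\le u_K^\infty\le M^\infty$ for all $K\in\mathcal T$, $$m^\infty\min\Big(1,\min_{L\in\mathcal T}\frac{u_L^0}{u_L^\infty}\Big)\le u_K^n\le M^\infty\max\Big(1,\max_{L\in\mathcal T}\frac{u_L^0}{u_L^\infty}\Big)\qquad\text{for all }K\in\mathcal T,\ n\ge0.$$ -/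

import Mathlib

open MeasureTheory

noncomputable section

namespace TPFA

/-- The Euclidean plane. -/
abbrev Plane : Type := EuclideanSpace ℝ (Fin 2)

/-- A connected bounded open polygonal set: its boundary is a finite union of segments, and it
lies on one side of its boundary (no cracks, no isolated boundary points). -/
structure IsPolygonalDomain (Ω : Set Plane) : Prop where
  isOpen : IsOpen Ω
  isConnected : IsConnected Ω
  isBounded : Bornology.IsBounded Ω
  interior_closure : interior (closure Ω) = Ω
  frontier_eq : ∃ S : Finset (Plane × Plane), frontier Ω = ⋃ p ∈ S, segment ℝ p.1 p.2

/-- `V ∈ C¹(closure Ω)`: `V` is continuous on the closure, differentiable in `Ω`, and its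
derivative extends continuously to the closure. -/
def IsC1OnClosure (Ω : Set Plane) (V : Plane → ℝ) : Prop :=
  ContinuousOn V (closure Ω) ∧
    ∃ G : Plane → (Plane →L[ℝ] ℝ), ContinuousOn G (closure Ω) ∧ ∀ x ∈ Ω, HasFDerivAt V (G x) x

/-- The properties required from the mean function `r : (0,∞)² → (0,∞)`. -/
structure IsMeanFunction (r : ℝ → ℝ → ℝ) : Prop where
  pos : ∀ x y, 0 < x → 0 < y → 0 < r x y
  mono_left : ∀ x x' y, 0 < x → 0 < y → x ≤ x' → r x y ≤ r x' y
  mono_right : ∀ x y y', 0 < x → 0 < y → y ≤ y' → r x y ≤ r x y'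
  diag : ∀ x, 0 < x → r x x = x
  symm : ∀ x y, 0 < x → 0 < y → r x y = r y x
  homogeneous : ∀ c x y, 0 < c → 0 < x → 0 < y → r (c * x) (c * y) = c * r x y
  log_mean_le : ∀ x y, 0 < x → 0 < y → x ≠ y → (x - y) / (Real.log x - Real.log y) ≤ r x y
  le_max : ∀ x y, 0 < x → 0 < y → x ≠ y → r x y ≤ max x y

/-- The combinatorial and geometric data of a mesh: control volumes and their centers indexed by
`T`, edges (given by their end points) indexed by `E`, and the finite set of the edges of each
control volume. -/
structure MeshData (T E : Type*) where
  cell : T → Set Plane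
  center : T → Plane
  endA : E → Plane
  endB : E → Plane
  edges : T → Finset E

namespace MeshData

variable {T E : Type*} (M : MeshData T E)

/-- An edge, as a relatively open segment. -/
def edge (σ : E) : Set Plane := openSegment ℝ (M.endA σ) (M.endB σ)

/-- A closed edge. -/
def closedEdge (σ : E) : Set Plane := segment ℝ (M.endA σ) (M.endB σ)

/-- The center `x_σ` of an edge. -/
def edgeCenter (σ : E) : Plane := midpoint ℝ (M.endA σ) (M.endB σ)

/-- The straight line that contains an edge. -/
def edgeLine (σ : E) : Set Plane := (affineSpan ℝ {M.endA σ, M.endB σ} : AffineSubspace ℝ Plane)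

/-- `σ = K|L`: the edge `σ` is shared by the distinct control volumes `K` and `L`. -/
def IsInterface (K L : T) (σ : E) : Prop := K ≠ L ∧ σ ∈ M.edges K ∧ σ ∈ M.edges L

/-- `m_K`, the area of a control volume. -/
def cellMeasure (K : T) : ℝ := (volume (M.cell K)).toReal

/-- `m_σ`, the length of an edge. -/
def edgeMeasure (σ : E) : ℝ := (Measure.hausdorffMeasure 1 (M.edge σ)).toReal

open Classical in
/-- `d_σ`: the distance between the two centers if `σ = K|L`, and the distance from `x_K` to the
line containing `σ` if `σ` is a boundary edge of `K`. -/
def edgeDist (σ : E) : ℝ :=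
  if h : ∃ p : T × T, M.IsInterface p.1 p.2 σ then
    dist (M.center h.choose.1) (M.center h.choose.2)
  else if h : ∃ K, σ ∈ M.edges K then Metric.infDist (M.center h.choose) (M.edgeLine σ)
  else 0

/-- The transmissibility `τ_σ = m_σ / d_σ`. -/
def transmissibility (σ : E) : ℝ := M.edgeMeasure σ / M.edgeDist σ

/-- The mesh is an admissible finite volume mesh of `Ω` with the orthogonality property, each
center lies in its control volume, the boundary edges are compatible with the splitting
`∂Ω = ΓD ∪ ΓN`, and the mesh is regular. -/
structure IsAdmissible (Ω ΓD ΓN : Set Plane) : Prop where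
  cell_isOpen : ∀ K, IsOpen (M.cell K)
  cell_convex : ∀ K, Convex ℝ (M.cell K)
  cell_subset : ∀ K, M.cell K ⊆ Ω
  cell_disjoint : ∀ K L, K ≠ L → Disjoint (M.cell K) (M.cell L)
  closure_iUnion_cell : closure (⋃ K, M.cell K) = closure Ω
  endA_ne_endB : ∀ σ, M.endA σ ≠ M.endB σ
  edge_disjoint : ∀ σ σ', σ ≠ σ' → Disjoint (M.edge σ) (M.edge σ')
  exists_mem_edges : ∀ σ, ∃ K, σ ∈ M.edges K
  frontier_cell : ∀ K, frontier (M.cell K) = ⋃ σ ∈ M.edges K, M.closedEdge σ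
  closure_inter_closure : ∀ K L, K ≠ L →
    Measure.hausdorffMeasure 1 (closure (M.cell K) ∩ closure (M.cell L)) = 0 ∨
      ∃ σ, M.IsInterface K L σ ∧ closure (M.cell K) ∩ closure (M.cell L) = M.closedEdge σ
  center_mem : ∀ K, M.center K ∈ M.cell K
  orthogonal : ∀ K L σ, M.IsInterface K L σ →
    inner ℝ (M.center L - M.center K) (M.endB σ - M.endA σ) = 0
  /-- For a boundary edge, the line through the center orthogonal to the edge meets the edge. -/
  exists_foot : ∀ K, ∀ σ ∈ M.edges K, M.edge σ ⊆ frontier Ω →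
    ∃ y ∈ M.closedEdge σ, inner ℝ (y - M.center K) (M.endB σ - M.endA σ) = 0
  boundary_edge : ∀ σ, M.edge σ ⊆ frontier Ω → M.edge σ ⊆ ΓD ∨ M.edge σ ⊆ ΓN
  regular : ∃ ζ : ℝ, 0 < ζ ∧ ∀ K, ∀ σ ∈ M.edges K,
    ζ * M.edgeDist σ ≤ Metric.infDist (M.center K) (M.edgeLine σ)

/-- The Dirichlet boundary edges: those included in `ΓD`. -/
def dirichletEdges (ΓD : Set Plane) : Set E := {σ | M.edge σ ⊆ ΓD}

/-- Discrete vectors `(u_𝒯, u_{ℰ^D})`: one value per control volume and one per Dirichlet edge. -/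
abbrev DiscreteVector (ΓD : Set Plane) : Type _ := (T → ℝ) × (M.dirichletEdges ΓD → ℝ)

variable {M} {ΓD : Set Plane}

open Classical in
/-- The neighbor unknown `u_{K,σ}`: `u_L` if `σ = K|L`, `u_σ` on a Dirichlet edge, `u_K` on a
Neumann edge. -/
def neighborValue (u : M.DiscreteVector ΓD) (K : T) (σ : E) : ℝ :=
  if h : ∃ L, M.IsInterface K L σ then u.1 h.choose
  else if h : σ ∈ M.dirichletEdges ΓD then u.2 ⟨σ, h⟩
  else u.1 K

/-- The difference operator `D_{K,σ} u = u_{K,σ} - u_K`. -/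
def diff (u : M.DiscreteVector ΓD) (K : T) (σ : E) : ℝ := neighborValue u K σ - u.1 K

/-- The componentwise logarithm of a discrete vector. -/
def logVector (u : M.DiscreteVector ΓD) : M.DiscreteVector ΓD :=
  (fun K => Real.log (u.1 K), fun σ => Real.log (u.2 σ))

variable (M ΓD) in
/-- The discrete potential: `V_K = V(x_K)`, `V_σ = V(x_σ)`. -/
def potential (V : Plane → ℝ) : M.DiscreteVector ΓD :=
  (fun K => V (M.center K), fun σ => V (M.edgeCenter σ))

/-- The numerical flux `F_{K,σ} = - τ_σ r(u_K, u_{K,σ}) D_{K,σ}(log u + V)`. On a Neumann edge the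
last factor vanishes, so the value of the mean is irrelevant there. -/
def flux (r : ℝ → ℝ → ℝ) (V : Plane → ℝ) (u : M.DiscreteVector ΓD) (K : T) (σ : E) : ℝ :=
  -(M.transmissibility σ * r (u.1 K) (neighborValue u K σ) *
    diff (logVector u + M.potential ΓD V) K σ)

variable (M) in
/-- The discrete initial datum `u_K^0`, the mean value of `u₀` over `K`. -/
def initialValue (u₀ : Plane → ℝ) (K : T) : ℝ := 1 / M.cellMeasure K * ∫ x in M.cell K, u₀ x

/-- `(uⁿ)_{n ≥ 0}` is a solution to the nonlinear TPFA scheme with mean function `r`, potential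
`V`, Dirichlet datum `uD`, initial datum `u₀` and time step `dt`. Positivity is part of the
notion of a solution, as the scheme involves `log uⁿ` and `r` is a function on `(0,∞)²`. -/
structure IsSolution (r : ℝ → ℝ → ℝ) (V uD u₀ : Plane → ℝ) (dt : ℝ)
    (u : ℕ → M.DiscreteVector ΓD) : Prop where
  pos : ∀ n K, 0 < (u n).1 K
  initial : ∀ K, (u 0).1 K = M.initialValue u₀ K
  dirichlet : ∀ n (σ : M.dirichletEdges ΓD), (u (n + 1)).2 σ = uD (M.edgeCenter σ)
  balance : ∀ n K, M.cellMeasure K * (((u (n + 1)).1 K - (u n).1 K) / dt) +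
    ∑ σ ∈ M.edges K, flux r V (u (n + 1)) K σ = 0

variable (M ΓD) in
open Classical in
/-- The discrete steady state `u_K^∞ = ρ exp(-V_K)`. If there are Dirichlet edges, on which
`log uD + V = αD`, then `ρ = exp αD`; otherwise `ρ = (∫_Ω u₀) / ∑_K m_K exp(-V_K)`. -/
def steadyState [Fintype T] (Ω : Set Plane) (V u₀ : Plane → ℝ) (αD : ℝ) (K : T) : ℝ :=
  (if (M.dirichletEdges ΓD).Nonempty then Real.exp αD
    else (∫ x in Ω, u₀ x) / ∑ L, M.cellMeasure L * Real.exp (-V (M.center L))) *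
    Real.exp (-V (M.center K))

end MeshData

end TPFA

end

/-!
# Existence of bounded solutions to the nonlinear TPFA scheme

Write the unknown as `u_K = u_K^∞ exp w_K`. The steady state satisfies `log u_K^∞ + V_K = c` with
the same constant `c` as the Dirichlet data, so `D_{K,σ}(log u + V)` becomes the difference of `w`
across `σ`, with the value `0` on Dirichlet edges (`diff_logVector_expState`). Since
transmissibilities and means are nonnegative, one implicit time step is a continuous system
`G_K(w) = 0` which obeys a maximum principle: if the previous iterate lies between `A u^∞` and
`B u^∞` with `A ≤ 1 ≤ B`, then on the box `[log A, log B]^T` each `G_K` is nonpositive on the face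
`w_K = log A` and nonnegative on the face `w_K = log B`. The Poincaré-Miranda theorem gives a zero
in the box, so the step is solvable and the same bounds hold for the new iterate
(`exists_time_step`). Iterating with `A = min 1 (min u⁰/u^∞)` and `B = max 1 (max u⁰/u^∞)` gives the
claim. The system need not be monotone, because the coefficients `r(u_K, u_L)` depend on the
solution; this is why a topological argument is used. The mean function is not assumed continuous:
continuity follows from monotonicity and homogeneity.

The Poincaré-Miranda theorem (`exists_eq_zero_of_sign_on_faces`) is derived from a form of Brouwer's
fixed point theorem, itself obtained from the absence of `C¹` retractions of a ball onto its sphere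
by the volume argument of Milnor and Rogers (`no_contDiff_retraction`): for a retraction `ρ`, the
integral over the ball of the Jacobian of `(1 - t) id + t ρ` is a polynomial in `t`. For small `t` it
is the volume of the ball, as the map is then a bijection of the ball, while for `t = 1` it vanishes,
as `ρ` has values in a sphere.
-/

/-! ### Jacobians of affine homotopies -/

namespace TPFA

open Polynomial Metric Set Filter Topology

theorem exists_polynomial_eval_eq_det {E : Type*} [NormedAddCommGroup E] [NormedSpace ℝ E]
    [FiniteDimensional ℝ E] (A : E →L[ℝ] E) :
    ∃ p : ℝ[X], p.natDegree ≤ Module.finrank ℝ E ∧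
      ∀ t : ℝ, p.eval t = (ContinuousLinearMap.id ℝ E + t • A).det := by
  classical
  set b := Module.finBasis ℝ E
  set N := LinearMap.toMatrix b b (A : E →ₗ[ℝ] E)
  refine ⟨Matrix.det ((X : ℝ[X]) • N.map C + (1 : Matrix _ _ ℝ).map C), ?_, fun t => ?_⟩
  · simpa using natDegree_det_X_add_C_le N 1
  · have h : (ContinuousLinearMap.id ℝ E + t • A).det =
        LinearMap.det ((LinearMap.id : E →ₗ[ℝ] E) + t • (A : E →ₗ[ℝ] E)) := rfl
    rw [h, ← LinearMap.det_toMatrix b, map_add, map_smul, LinearMap.toMatrix_id, add_comm,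
      ← coe_evalRingHom, RingHom.map_det]
    congr 1
    ext i j
    by_cases hij : i = j <;> simp [N, hij, mul_comm t]

/-- The polynomial `t ↦ det (1 + t A)` is recovered from its values at the nodes `v j` by Lagrange
interpolation. This form can be integrated in `A` without handling the coefficients. -/
theorem det_eq_sum_lagrange {E : Type*} [NormedAddCommGroup E] [NormedSpace ℝ E]
    [FiniteDimensional ℝ E] (A : E →L[ℝ] E) {v : ℕ → ℝ} (hv : Function.Injective v) (t : ℝ) :
    (ContinuousLinearMap.id ℝ E + t • A).det =
      ∑ j ∈ Finset.range (Module.finrank ℝ E + 1),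
        (ContinuousLinearMap.id ℝ E + v j • A).det *
          (Lagrange.basis (Finset.range (Module.finrank ℝ E + 1)) v j).eval t := by
  obtain ⟨p, hp, hpt⟩ := exists_polynomial_eval_eq_det A
  have hdeg : p.degree < (Finset.range (Module.finrank ℝ E + 1)).card := by
    rw [Finset.card_range]
    exact lt_of_le_of_lt degree_le_natDegree (by exact_mod_cast Nat.lt_succ_of_le hp)
  have h := congrArg (eval t) (Lagrange.eq_interpolate (v := v) hv.injOn hdeg)
  rw [← hpt, h, Lagrange.interpolate_apply, eval_finsetSum]
  simp [hpt]

/-! ### Retractions and fixed points -/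

section Retraction

variable {E : Type*} [NormedAddCommGroup E] [InnerProductSpace ℝ E]

/-- A map that vanishes on the sphere and outside the ball is Lipschitz as soon as it is on the ball:
a segment that leaves the ball crosses the sphere. -/
theorem lipschitzWith_of_eq_zero_off_ball {φ : E → E} {R : ℝ} {C : NNReal}
    (hφ : LipschitzOnWith C φ (closedBall 0 R)) (h0 : ∀ x, R ≤ ‖x‖ → φ x = 0) :
    LipschitzWith C φ := by
  have key : ∀ x y : E, ‖x‖ ≤ R → R ≤ ‖y‖ → dist (φ x) (φ y) ≤ C * dist x y := by
    intro x y hx hy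
    have hc : Continuous fun s : ℝ => ‖AffineMap.lineMap x y s‖ := by
      simp only [AffineMap.lineMap_apply_module]; fun_prop
    obtain ⟨s, hs, hs'⟩ := intermediate_value_Icc (zero_le_one' ℝ) hc.continuousOn
      (show R ∈ Icc _ _ by simpa using ⟨hx, hy⟩)
    have h1 := hφ.dist_le_mul x (by simpa using hx) (AffineMap.lineMap x y s)
      (by simpa using hs'.le)
    rw [h0 _ hs'.ge] at h1
    rw [h0 y hy]
    refine h1.trans (mul_le_mul_of_nonneg_left ?_ C.2)
    rw [dist_left_lineMap, Real.norm_of_nonneg hs.1]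
    exact mul_le_of_le_one_left dist_nonneg hs.2
  refine LipschitzWith.of_dist_le_mul fun x y => ?_
  rcases le_total ‖x‖ R with hx | hx <;> rcases le_total ‖y‖ R with hy | hy
  · exact hφ.dist_le_mul x (by simpa using hx) y (by simpa using hy)
  · exact key x y hx hy
  · rw [dist_comm, dist_comm x]; exact key y x hy hx
  · rw [h0 x hx, h0 y hy, dist_self]; positivity

/-- The equation `x + t φ x = y` says that `x` is the fixed point of the contraction
`x ↦ y - t φ x`. -/
theorem id_add_smul_bijective [CompleteSpace E] {φ : E → E} {C : NNReal} (hφ : LipschitzWith C φ)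
    {t : ℝ} (ht : ‖t‖₊ * C < 1) : Function.Bijective fun x => x + t • φ x := by
  have hl : ∀ y, ContractingWith (‖t‖₊ * C) fun x => y - t • φ x := fun y => by
    refine ⟨ht, LipschitzWith.of_dist_le_mul fun a b => ?_⟩
    rw [dist_sub_left, dist_smul₀]
    push_cast
    rw [mul_assoc]
    exact mul_le_mul_of_nonneg_left (hφ.dist_le_mul a b) (norm_nonneg _)
  refine ⟨fun a b hab => ?_, fun y => ?_⟩
  · refine (hl (a + t • φ a)).fixedPoint_unique' (x := a) (y := b) ?_ ?_
    · simp [Function.IsFixedPt]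
    · simp only at hab
      simp [Function.IsFixedPt, hab]
  · refine ⟨ContractingWith.fixedPoint _ (hl y), ?_⟩
    have h := (hl y).fixedPoint_isFixedPt
    exact (sub_eq_iff_eq_add.1 h).symm

/-- The differential of a map with values in a sphere has its range orthogonal to the value, so it is
not surjective. -/
theorem det_fderiv_eq_zero_of_norm_eq [FiniteDimensional ℝ E] {ρ : E → E} {R : ℝ} (hR : 0 < R)
    (hρ : Differentiable ℝ ρ) (hn : ∀ x, ‖ρ x‖ = R) (x : E) : (fderiv ℝ ρ x).det = 0 := by
  have h1 : ∀ v, inner ℝ (ρ x) (fderiv ℝ ρ x v) = 0 := by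
    intro v
    have h2 := ((hρ x).hasFDerivAt.norm_sq).fderiv
    have h3 : (fun y => ‖ρ y‖ ^ 2) = fun _ => R ^ 2 := by ext y; rw [hn]
    rw [h3] at h2
    have h4 := congrArg (fun L => L v) h2
    simpa using h4.symm
  by_contra hd
  have hs : Function.Surjective (fderiv ℝ ρ x) := by
    have := (LinearMap.equivOfDetNeZero (fderiv ℝ ρ x : E →ₗ[ℝ] E) hd).surjective
    exact this
  obtain ⟨v, hv⟩ := hs (ρ x)
  have h5 := h1 v
  rw [hv, inner_self_eq_zero] at h5
  have := hn x
  rw [h5, norm_zero] at this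
  exact hR.ne this

/-- There is no `C¹` retraction onto a sphere of the ball that it bounds. It is convenient, and enough
below, to have the map defined on the whole space with values in the sphere. -/
theorem no_contDiff_retraction [FiniteDimensional ℝ E] {ρ : E → E} {R : ℝ} (hR : 0 < R)
    (hρ : ContDiff ℝ 1 ρ) (hn : ∀ x, ‖ρ x‖ = R) (hid : ∀ x, ‖x‖ = R → ρ x = x) : False := by
  let _ : MeasurableSpace E := borel E
  have _ : BorelSpace E := ⟨rfl⟩
  set A : E → E →L[ℝ] E := fun x => fderiv ℝ ρ x - ContinuousLinearMap.id ℝ E with hA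
  have hAc : Continuous A := (hρ.continuous_fderiv one_ne_zero).sub continuous_const
  have hA' : ∀ x, HasFDerivAt (fun y => ρ y - y) (A x) x := fun x =>
    ((hρ.differentiable one_ne_zero x).hasFDerivAt).sub (hasFDerivAt_id x)
  have hdetc : Continuous fun p : ℝ × E => (ContinuousLinearMap.id ℝ E + p.1 • A p.2).det :=
    ContinuousLinearMap.continuous_det.comp (by fun_prop)
  -- The displacement `ρ - id` on the ball, extended by zero, is globally Lipschitz.
  obtain ⟨C, hC⟩ : ∃ C : NNReal, ∀ x ∈ closedBall (0 : E) R, ‖A x‖₊ ≤ C := by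
    obtain ⟨C, hC⟩ := (isCompact_closedBall (0 : E) R).exists_bound_of_continuousOn
      hAc.continuousOn
    exact ⟨C.toNNReal, fun x hx => by
      rw [← NNReal.coe_le_coe]; exact (hC x hx).trans (Real.le_coe_toNNReal C)⟩
  have hlip0 : LipschitzOnWith C (fun y => ρ y - y) (closedBall 0 R) :=
    (convex_closedBall (0 : E) R).lipschitzOnWith_of_nnnorm_hasFDerivWithin_le
      (fun x _ => (hA' x).hasFDerivWithinAt) hC
  set φ : E → E := fun x => if ‖x‖ ≤ R then ρ x - x else 0 with hφ
  have hφ0 : ∀ x, R ≤ ‖x‖ → φ x = 0 := by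
    intro x hx
    by_cases h : ‖x‖ ≤ R
    · simp [hφ, h, hid x (le_antisymm h hx)]
    · simp [hφ, h]
  have hφin : ∀ x, ‖x‖ ≤ R → φ x = ρ x - x := fun x hx => by simp [hφ, hx]
  have hlip : LipschitzWith C φ := by
    refine lipschitzWith_of_eq_zero_off_ball (R := R) (fun x hx y hy => ?_) hφ0
    rw [hφin x (by simpa using hx), hφin y (by simpa using hy)]
    exact hlip0 hx hy
  -- For small `t`, the map `id + t φ` is a bijection of the space that fixes the complement of the
  -- ball, hence a bijection of the ball, and its Jacobian on the ball is positive.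
  have hvol : ∀ᶠ t : ℝ in 𝓝 0, ∫ x in ball (0 : E) R,
      (ContinuousLinearMap.id ℝ E + t • A x).det = volume.real (ball (0 : E) R) := by
    have hpos : ∀ᶠ t : ℝ in 𝓝 0, ∀ x ∈ closedBall (0 : E) R,
        0 < (ContinuousLinearMap.id ℝ E + t • A x).det := by
      refine (isCompact_closedBall (0 : E) R).eventually_forall_of_forall_eventually ?_
      intro x _
      refine hdetc.continuousAt.eventually (lt_mem_nhds ?_)
      simp [ContinuousLinearMap.det]
    have hsmall : ∀ᶠ t : ℝ in 𝓝 0, ‖t‖₊ * C < 1 := by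
      have : Continuous fun t : ℝ => ‖t‖₊ * C := by fun_prop
      exact this.continuousAt.eventually (gt_mem_nhds (by simp))
    filter_upwards [hpos, hsmall] with t ht hts
    have hbij := id_add_smul_bijective hlip hts
    have himg : (fun x => x + t • φ x) '' ball (0 : E) R = ball 0 R := by
      have hcompl : ∀ x, R ≤ ‖x‖ → x + t • φ x = x := fun x hx => by simp [hφ0 x hx]
      apply Subset.antisymm
      · rintro _ ⟨x, hx, rfl⟩
        by_contra hy
        simp only [mem_ball_zero_iff, not_lt] at hx hy
        have := hbij.1 (hcompl _ hy)
        simp only at this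
        rw [this] at hy
        exact absurd hx (not_lt.2 hy)
      · intro y hy
        obtain ⟨x, rfl⟩ := hbij.2 y
        refine ⟨x, ?_, rfl⟩
        by_contra hx
        simp only [mem_ball_zero_iff, not_lt] at hx hy
        rw [hcompl x hx] at hy
        exact absurd hy (not_lt.2 hx)
    have hder : ∀ x ∈ ball (0 : E) R, HasFDerivWithinAt (fun x => x + t • φ x)
        (ContinuousLinearMap.id ℝ E + t • A x) (ball 0 R) x := by
      intro x hx
      have h1 : HasFDerivWithinAt (fun y => y + t • (ρ y - y))
          (ContinuousLinearMap.id ℝ E + t • A x) (ball 0 R) x :=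
        ((hasFDerivAt_id x).add ((hA' x).const_smul t)).hasFDerivWithinAt
      have h2 : ∀ y ∈ ball (0 : E) R, y + t • φ y = y + t • (ρ y - y) := fun y hy => by
        rw [hφin y (mem_ball_zero_iff.1 hy).le]
      exact h1.congr h2 (h2 x hx)
    have hcv := integral_image_eq_integral_abs_det_fderiv_smul volume measurableSet_ball hder
      hbij.1.injOn (fun _ => (1 : ℝ))
    rw [himg] at hcv
    simp only [integral_const, smul_eq_mul, mul_one, measureReal_restrict_apply_univ] at hcv
    rw [hcv]
    refine setIntegral_congr_fun measurableSet_ball fun x hx => ?_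
    exact (abs_of_pos (ht x (ball_subset_closedBall hx))).symm
  obtain ⟨ε, hε, hvol⟩ := Metric.eventually_nhds_iff.1 hvol
  -- Interpolation nodes in the range of `t` where the integral is known.
  set v : ℕ → ℝ := fun j => ε / (j + 2) with hv
  have hvinj : Function.Injective v := by
    intro i j hij
    simp only [hv] at hij
    field_simp at hij
    exact_mod_cast (by linarith : (i : ℝ) = j)
  have hvε : ∀ j, dist (v j) 0 < ε := by
    intro j
    have hj : (0 : ℝ) < (j : ℝ) + 2 := by positivity
    rw [Real.dist_0_eq_abs, abs_of_pos (div_pos hε hj), div_lt_iff₀ hj]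
    nlinarith [(Nat.cast_nonneg j : (0 : ℝ) ≤ j)]
  set s := Finset.range (Module.finrank ℝ E + 1)
  have hint : ∀ t : ℝ, IntegrableOn
      (fun x => (ContinuousLinearMap.id ℝ E + t • A x).det) (ball (0 : E) R) := by
    intro t
    have : Continuous fun x => (ContinuousLinearMap.id ℝ E + t • A x).det :=
      hdetc.comp (by fun_prop : Continuous fun x : E => (t, x))
    exact (this.continuousOn.integrableOn_compact (isCompact_closedBall (0 : E) R)).mono_set
      ball_subset_closedBall
  have hzero : ∫ x in ball (0 : E) R, (ContinuousLinearMap.id ℝ E + (1 : ℝ) • A x).det = 0 := by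
    have : ∀ x, (ContinuousLinearMap.id ℝ E + (1 : ℝ) • A x).det = 0 := fun x => by
      rw [one_smul, hA, add_sub_cancel]
      exact det_fderiv_eq_zero_of_norm_eq hR (hρ.differentiable one_ne_zero) hn x
    simp only [this, integral_zero]
  -- By interpolation the integral is constant in `t`, since the Lagrange basis sums to `1`.
  have hone : ∫ x in ball (0 : E) R, (ContinuousLinearMap.id ℝ E + (1 : ℝ) • A x).det =
      volume.real (ball (0 : E) R) := by
    simp_rw [fun x => det_eq_sum_lagrange (A x) hvinj 1]
    rw [integral_finsetSum _ fun j _ => (hint (v j)).mul_const _]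
    simp_rw [integral_mul_const, hvol (hvε _)]
    rw [← Finset.mul_sum, ← eval_finsetSum,
      Lagrange.sum_basis hvinj.injOn ⟨0, by simp⟩]
    simp
  have hball : 0 < volume.real (ball (0 : E) R) :=
    ENNReal.toReal_pos (measure_ball_pos volume 0 hR).ne' measure_ball_lt_top.ne
  linarith

/-- If `f` had no zero, a `C¹` approximation `g` of `f` equal to the identity near infinity would have
none either, and `(R + 1) g / ‖g‖` would be a retraction onto the sphere of radius `R + 1`. -/
theorem exists_eq_zero_of_eq_id_off_ball [FiniteDimensional ℝ E] {f : E → E} {R : ℝ} (hR : 0 < R)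
    (hf : Continuous f) (hid : ∀ x, R ≤ ‖x‖ → f x = x) : ∃ x, f x = 0 := by
  by_contra! hne
  have hR1 : 0 < R + 1 := by linarith
  obtain ⟨g, hg, hgf, hgid, -⟩ := hf.exists_contDiff_approx_and_eqOn (n := 1)
    (ε := fun x => ‖f x‖) hf.norm (fun x => norm_pos_iff.2 (hne x))
    (S := {x | R + 1 ≤ ‖x‖}) (U := {x | R < ‖x‖})
    (isClosed_le continuous_const continuous_norm)
    ((isOpen_lt continuous_const continuous_norm).mem_nhdsSet.2
      fun x (hx : R + 1 ≤ ‖x‖) => by exact (lt_add_one R).trans_le hx)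
    (contDiffOn_id.congr fun x (hx : R < ‖x‖) => hid x hx.le)
  have hg0 : ∀ x, g x ≠ 0 := by
    intro x h
    have := hgf x
    rw [h, dist_zero_left] at this
    exact lt_irrefl _ this
  refine no_contDiff_retraction (ρ := fun x => ((R + 1) / ‖g x‖) • g x) hR1 ?_ ?_ ?_
  · exact (contDiff_const.div (hg.norm ℝ hg0) fun x => norm_ne_zero_iff.2 (hg0 x)).smul hg
  · intro x
    have := norm_pos_iff.2 (hg0 x)
    rw [norm_smul, Real.norm_of_nonneg (by positivity), div_mul_cancel₀ _ this.ne']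
  · intro x hx
    have h1 : g x = x := (hgid (show R + 1 ≤ ‖x‖ from hx.ge)).trans (hid x (by linarith))
    simp only [h1, hx, div_self hR1.ne', one_smul]

/-- **Brouwer's fixed point theorem**, for bounded continuous maps of the whole space. -/
theorem exists_isFixedPt_of_norm_le [FiniteDimensional ℝ E] {h : E → E} {R : ℝ}
    (hc : Continuous h) (hb : ∀ x, ‖h x‖ ≤ R) : ∃ x, h x = x := by
  wlog hR : 0 < R generalizing R
  · exact this (R := |R| + 1) (fun x => (hb x).trans (by linarith [le_abs_self R])) (by positivity)
  -- A cutoff equal to `1` on the ball of radius `R` and to `0` outside the ball of radius `2 R`.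
  set χ : E → ℝ := fun x => max 0 (min 1 (2 - ‖x‖ / R)) with hχ
  have hχc : Continuous χ := by fun_prop
  obtain ⟨x, hx⟩ := exists_eq_zero_of_eq_id_off_ball (f := fun x => x - χ x • h x)
    (R := 2 * R) (by positivity) (by fun_prop) (fun x hx => by
      have : 2 - ‖x‖ / R ≤ 0 := by
        rw [sub_nonpos, le_div_iff₀ hR]; exact hx
      have : χ x = 0 := max_eq_left ((min_le_right _ _).trans this)
      simp [this])
  rw [sub_eq_zero] at hx
  have hχ01 : |χ x| ≤ 1 := by
    rw [abs_of_nonneg (le_max_left _ _)]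
    exact max_le zero_le_one (min_le_left _ _)
  have hxR : ‖x‖ ≤ R := by
    rw [hx, norm_smul, Real.norm_eq_abs]
    exact (mul_le_of_le_one_left (norm_nonneg _) hχ01).trans (hb x)
  have h1 : χ x = 1 := by
    have : ‖x‖ / R ≤ 1 := (div_le_one hR).2 hxR
    simp only [hχ]
    rw [min_eq_left (by linarith), max_eq_right zero_le_one]
  exact ⟨x, by rw [h1, one_smul] at hx; exact hx.symm⟩

end Retraction

/-- **Poincaré-Miranda theorem**: a continuous map on a box, each component of which is nonpositive on
the lower face and nonnegative on the upper face in its direction, has a zero in the box. -/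
theorem exists_eq_zero_of_sign_on_faces {ι : Type*} [Fintype ι] {a b : ι → ℝ} (hab : a ≤ b)
    {F : (ι → ℝ) → ι → ℝ} (hF : ContinuousOn F (Icc a b))
    (ha : ∀ x ∈ Icc a b, ∀ i, x i = a i → F x i ≤ 0)
    (hb : ∀ x ∈ Icc a b, ∀ i, x i = b i → 0 ≤ F x i) : ∃ x ∈ Icc a b, F x = 0 := by
  -- `c` is the projection onto the box; zeros of `F` are the fixed points of `c ∘ (id - F) ∘ c`.
  set c : (ι → ℝ) → ι → ℝ := fun x => a ⊔ (b ⊓ x) with hc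
  have hcc : Continuous c :=
    continuous_pi fun i => continuous_const.max (continuous_const.min (continuous_apply i))
  have hcm : ∀ x, c x ∈ Icc a b := fun x => ⟨le_sup_left, sup_le hab inf_le_left⟩
  have hcid : ∀ x ∈ Icc a b, c x = x := fun x hx => by
    simp only [hc]; rw [inf_eq_right.2 hx.2, sup_eq_right.2 hx.1]
  have hGc : Continuous fun x => c (c x - F (c x)) :=
    hcc.comp (hcc.sub (hF.comp_continuous hcc hcm))
  obtain ⟨R, hR⟩ := (isCompact_Icc (a := a) (b := b)).exists_bound_of_continuousOn
    (f := fun x => (WithLp.toLp 2 x : EuclideanSpace ℝ ι))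
    (PiLp.continuous_toLp 2 _).continuousOn
  obtain ⟨y, hy⟩ := exists_isFixedPt_of_norm_le (E := EuclideanSpace ℝ ι)
    (h := fun y => WithLp.toLp 2 (c (c y.ofLp - F (c y.ofLp)))) (R := R)
    ((PiLp.continuous_toLp 2 _).comp (hGc.comp (PiLp.continuous_ofLp 2 _)))
    (fun y => hR _ (hcm _))
  set x := y.ofLp
  have hx : c (c x - F (c x)) = x := congrArg WithLp.ofLp hy
  have hxm : x ∈ Icc a b := hx ▸ hcm _
  rw [hcid x hxm] at hx
  refine ⟨x, hxm, funext fun i => ?_⟩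
  have hi : max (a i) (min (b i) (x i - F x i)) = x i := congrFun hx i
  have h1 := ha x hxm i
  have h2 := hb x hxm i
  have h3 := hxm.1 i
  have h4 := hxm.2 i
  rw [Pi.zero_apply]
  generalize x i = s at *
  generalize F x i = z at *
  clear hx hxm
  rcases lt_trichotomy z 0 with hz | hz | hz
  · have hsb : s ≠ b i := fun h => (h2 h).not_gt hz
    have hsb' : s < b i := lt_of_le_of_ne h4 hsb
    have : s < max (a i) (min (b i) (s - z)) :=
      lt_max_of_lt_right (lt_min hsb' (by linarith))
    exact absurd hi this.ne'
  · exact hz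
  · have hsa : s ≠ a i := fun h => (h1 h).not_gt hz
    have hsa' : a i < s := lt_of_le_of_ne h3 hsa.symm
    have : max (a i) (min (b i) (s - z)) < s :=
      max_lt hsa' (min_lt_of_right_lt (by linarith))
    exact absurd hi this.ne

/-! ### The mean function -/

/-- Near `(x, y)`, monotonicity and homogeneity squeeze `r x' y'` between `r x y` multiplied by the
smaller and by the larger of the ratios `x' / x` and `y' / y`. -/
theorem IsMeanFunction.continuousOn {r : ℝ → ℝ → ℝ} (hr : IsMeanFunction r) :
    ContinuousOn (fun p : ℝ × ℝ => r p.1 p.2) {p | 0 < p.1 ∧ 0 < p.2} := by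
  rintro ⟨x, y⟩ ⟨hx, hy⟩
  simp only at hx hy
  refine ContinuousAt.continuousWithinAt ?_
  have hmin : Tendsto (fun p : ℝ × ℝ => min (p.1 / x) (p.2 / y) * r x y) (𝓝 (x, y))
      (𝓝 (r x y)) := by
    have : Continuous fun p : ℝ × ℝ => min (p.1 / x) (p.2 / y) * r x y := by fun_prop
    simpa [hx.ne', hy.ne'] using this.tendsto (x, y)
  have hmax : Tendsto (fun p : ℝ × ℝ => max (p.1 / x) (p.2 / y) * r x y) (𝓝 (x, y))
      (𝓝 (r x y)) := by
    have : Continuous fun p : ℝ × ℝ => max (p.1 / x) (p.2 / y) * r x y := by fun_prop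
    simpa [hx.ne', hy.ne'] using this.tendsto (x, y)
  have hpos : ∀ᶠ p : ℝ × ℝ in 𝓝 (x, y), 0 < p.1 ∧ 0 < p.2 :=
    (continuousAt_fst.eventually (lt_mem_nhds hx)).and
      (continuousAt_snd.eventually (lt_mem_nhds hy))
  refine tendsto_of_tendsto_of_tendsto_of_le_of_le' hmin hmax ?_ ?_ <;>
    filter_upwards [hpos] with p hp
  · have hc : 0 < min (p.1 / x) (p.2 / y) := lt_min (div_pos hp.1 hx) (div_pos hp.2 hy)
    rw [← hr.homogeneous _ _ _ hc hx hy]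
    have h1 := (le_div_iff₀ hx).1 (min_le_left (p.1 / x) (p.2 / y))
    have h2 := (le_div_iff₀ hy).1 (min_le_right (p.1 / x) (p.2 / y))
    exact (hr.mono_left _ _ _ (mul_pos hc hx) (mul_pos hc hy) h1).trans
      (hr.mono_right _ _ _ hp.1 (mul_pos hc hy) h2)
  · have hc : 0 < max (p.1 / x) (p.2 / y) := lt_max_of_lt_left (div_pos hp.1 hx)
    rw [← hr.homogeneous _ _ _ hc hx hy]
    have h1 := (div_le_iff₀ hx).1 (le_max_left (p.1 / x) (p.2 / y))
    have h2 := (div_le_iff₀ hy).1 (le_max_right (p.1 / x) (p.2 / y))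
    exact (hr.mono_left _ _ _ hp.1 hp.2 h1).trans
      (hr.mono_right _ _ _ (mul_pos hc hx) hp.2 h2)

/-! ### Signs and continuity of the discrete fluxes -/

namespace MeshData

variable {T E : Type*} {M : MeshData T E} {ΓD : Set Plane}

theorem edgeDist_nonneg (M : MeshData T E) (σ : E) : 0 ≤ M.edgeDist σ := by
  unfold edgeDist
  split_ifs
  exacts [dist_nonneg, Metric.infDist_nonneg, le_rfl]

theorem transmissibility_nonneg (M : MeshData T E) (σ : E) : 0 ≤ M.transmissibility σ :=
  div_nonneg ENNReal.toReal_nonneg (M.edgeDist_nonneg σ)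

theorem edgeCenter_mem_edge (M : MeshData T E) (σ : E) : M.edgeCenter σ ∈ M.edge σ := by
  refine ⟨1 / 2, 1 / 2, by norm_num, by norm_num, by norm_num, ?_⟩
  rw [edgeCenter, midpoint_eq_smul_add, smul_add]
  norm_num

variable (M ΓD) in
/-- The discrete vector `s_K exp w_K` with the Dirichlet values of `uD`, parametrized by the logarithm
`w` of the ratio to a positive reference state `s`. -/
noncomputable def expState (s : T → ℝ) (uD : Plane → ℝ) (w : T → ℝ) : M.DiscreteVector ΓD :=
  (fun K => s K * Real.exp (w K), fun σ => uD (M.edgeCenter σ))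

variable (M ΓD) in
/-- The relative logarithm `w` as a discrete vector, with the value `0` on the Dirichlet edges. -/
def relLog (w : T → ℝ) : M.DiscreteVector ΓD := (w, 0)

/-- If `log s + V` is the same constant in the cells and for the Dirichlet data, then it drops out of
the difference operator. -/
theorem diff_logVector_expState {s : T → ℝ} {V uD : Plane → ℝ} {c : ℝ} (hs : ∀ K, 0 < s K)
    (hc : ∀ K, Real.log (s K) + V (M.center K) = c)
    (hD : ∀ σ ∈ M.dirichletEdges ΓD, Real.log (uD (M.edgeCenter σ)) + V (M.edgeCenter σ) = c)
    (w : T → ℝ) (K : T) (σ : E) :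
    diff (logVector (expState M ΓD s uD w) + M.potential ΓD V) K σ = diff (relLog M ΓD w) K σ := by
  have hcell : ∀ L, (logVector (expState M ΓD s uD w) + M.potential ΓD V).1 L = c + w L := by
    intro L
    simp only [logVector, expState, potential, Prod.fst_add, Pi.add_apply]
    rw [Real.log_mul (hs L).ne' (Real.exp_ne_zero _), Real.log_exp, ← hc L]
    ring
  unfold diff neighborValue
  split_ifs with h1 h2
  · simp [hcell, relLog]
  · rw [hcell]
    simp only [logVector, expState, potential, Prod.snd_add, Pi.add_apply, relLog, Pi.zero_apply]
    rw [hD σ h2]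
    ring
  · simp

theorem diff_relLog_nonpos {w : T → ℝ} {K : T} (hw : ∀ L, w L ≤ w K) (h0 : 0 ≤ w K) (σ : E) :
    diff (relLog M ΓD w) K σ ≤ 0 := by
  unfold diff neighborValue relLog
  split_ifs
  · exact sub_nonpos.2 (hw _)
  · simpa using h0
  · simp

theorem diff_relLog_nonneg {w : T → ℝ} {K : T} (hw : ∀ L, w K ≤ w L) (h0 : w K ≤ 0) (σ : E) :
    0 ≤ diff (relLog M ΓD w) K σ := by
  unfold diff neighborValue relLog
  split_ifs
  · exact sub_nonneg.2 (hw _)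
  · simpa using h0
  · simp

theorem continuous_diff_relLog (K : T) (σ : E) :
    Continuous fun w => diff (relLog M ΓD w) K σ := by
  unfold diff neighborValue relLog
  split_ifs <;> simp only <;> fun_prop

theorem continuous_neighborValue_expState (s : T → ℝ) (uD : Plane → ℝ) (K : T) (σ : E) :
    Continuous fun w => neighborValue (expState M ΓD s uD w) K σ := by
  unfold neighborValue expState
  split_ifs <;> simp only <;> fun_prop

theorem neighborValue_pos {u : M.DiscreteVector ΓD} (h1 : ∀ K, 0 < u.1 K) (h2 : ∀ σ, 0 < u.2 σ)
    (K : T) (σ : E) : 0 < neighborValue u K σ := by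
  unfold neighborValue
  split_ifs
  exacts [h1 _, h2 _, h1 _]

/-! ### Existence of bounded solutions -/

/-- One implicit time step is solvable, and preserves two-sided bounds `s A ≤ u ≤ s B` by multiples of
the steady state `s` with `A ≤ 1 ≤ B`. -/
theorem exists_time_step [Fintype T] {r : ℝ → ℝ → ℝ} (hr : IsMeanFunction r) {V uD : Plane → ℝ}
    {dt : ℝ} (hdt : 0 < dt) {s : T → ℝ} {c : ℝ} (hs : ∀ K, 0 < s K)
    (hc : ∀ K, Real.log (s K) + V (M.center K) = c)
    (huD : ∀ σ ∈ M.dirichletEdges ΓD, 0 < uD (M.edgeCenter σ))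
    (hD : ∀ σ ∈ M.dirichletEdges ΓD, Real.log (uD (M.edgeCenter σ)) + V (M.edgeCenter σ) = c)
    {A B : ℝ} (hA : 0 < A) (hA1 : A ≤ 1) (hB1 : 1 ≤ B) {p : T → ℝ}
    (hp : ∀ K, s K * A ≤ p K ∧ p K ≤ s K * B) :
    ∃ u : M.DiscreteVector ΓD, (∀ K, s K * A ≤ u.1 K ∧ u.1 K ≤ s K * B) ∧
      (∀ σ, u.2 σ = uD (M.edgeCenter σ)) ∧
      ∀ K, M.cellMeasure K * ((u.1 K - p K) / dt) + ∑ σ ∈ M.edges K, flux r V u K σ = 0 := by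
  have hB : 0 < B := zero_lt_one.trans_le hB1
  have hm : ∀ K, 0 ≤ M.cellMeasure K := fun K => ENNReal.toReal_nonneg
  have hpos1 : ∀ w K, 0 < (expState M ΓD s uD w).1 K := fun w K =>
    mul_pos (hs K) (Real.exp_pos _)
  have hnpos : ∀ w K σ, 0 < neighborValue (expState M ΓD s uD w) K σ := fun w =>
    neighborValue_pos (hpos1 w) fun σ => huD σ σ.2
  have hflux : ∀ w K σ, flux r V (expState M ΓD s uD w) K σ =
      -(M.transmissibility σ *
        r ((expState M ΓD s uD w).1 K) (neighborValue (expState M ΓD s uD w) K σ) *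
        diff (relLog M ΓD w) K σ) := fun w K σ => by
    rw [flux, diff_logVector_expState hs hc hD]
  have hcoef : ∀ w K σ, 0 ≤ M.transmissibility σ *
      r ((expState M ΓD s uD w).1 K) (neighborValue (expState M ΓD s uD w) K σ) := fun w K σ =>
    mul_nonneg (M.transmissibility_nonneg σ) (hr.pos _ _ (hpos1 w K) (hnpos w K σ)).le
  have hfluxc : ∀ K σ, Continuous fun w => flux r V (expState M ΓD s uD w) K σ := by
    intro K σ
    simp only [hflux]
    have hcell : Continuous fun w => (expState M ΓD s uD w).1 K := by
      unfold expState; fun_prop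
    have h1 : Continuous fun w =>
        r ((expState M ΓD s uD w).1 K) (neighborValue (expState M ΓD s uD w) K σ) :=
      hr.continuousOn.comp_continuous
        (hcell.prodMk (continuous_neighborValue_expState s uD K σ))
        fun w => ⟨hpos1 w K, hnpos w K σ⟩
    exact ((continuous_const.mul h1).mul (continuous_diff_relLog K σ)).neg
  obtain ⟨w, hw, hw0⟩ := exists_eq_zero_of_sign_on_faces (a := fun _ : T => Real.log A)
    (b := fun _ => Real.log B)
    (F := fun w K => M.cellMeasure K * (((expState M ΓD s uD w).1 K - p K) / dt) +
      ∑ σ ∈ M.edges K, flux r V (expState M ΓD s uD w) K σ)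
    (fun _ => Real.log_le_log hA (hA1.trans hB1))
    (by
      refine (continuous_pi fun K => ?_).continuousOn
      refine Continuous.add ?_ (continuous_finsetSum _ fun σ _ => hfluxc K σ)
      unfold expState
      fun_prop)
    (by
      intro w hw K hK
      have hwK : w K = Real.log A := hK
      refine add_nonpos ?_ (Finset.sum_nonpos fun σ _ => ?_)
      · refine mul_nonpos_of_nonneg_of_nonpos (hm K) (div_nonpos_of_nonpos_of_nonneg ?_ hdt.le)
        simp only [expState]
        rw [hwK, Real.exp_log hA]
        linarith [(hp K).1]
      · rw [hflux, neg_nonpos]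
        exact mul_nonneg (hcoef w K σ) (diff_relLog_nonneg (fun L => hK.trans_le (hw.1 L))
          (hwK.trans_le (Real.log_nonpos hA.le hA1)) σ))
    (by
      intro w hw K hK
      have hwK : w K = Real.log B := hK
      refine add_nonneg ?_ (Finset.sum_nonneg fun σ _ => ?_)
      · refine mul_nonneg (hm K) (div_nonneg ?_ hdt.le)
        simp only [expState]
        rw [hwK, Real.exp_log hB]
        linarith [(hp K).2]
      · rw [hflux, neg_nonneg]
        exact mul_nonpos_of_nonneg_of_nonpos (hcoef w K σ)
          (diff_relLog_nonpos (fun L => (hw.2 L).trans_eq hK.symm)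
            ((Real.log_nonneg hB1).trans_eq hwK.symm) σ))
  refine ⟨expState M ΓD s uD w, fun K => ⟨?_, ?_⟩, fun σ => rfl, fun K => congrFun hw0 K⟩
  · exact mul_le_mul_of_nonneg_left ((Real.log_le_iff_le_exp hA).1 (hw.1 K)) (hs K).le
  · exact mul_le_mul_of_nonneg_left ((Real.le_log_iff_exp_le hB).1 (hw.2 K)) (hs K).le

theorem exists_isSolution_of_bounds [Fintype T] {r : ℝ → ℝ → ℝ} (hr : IsMeanFunction r)
    {V uD u₀ : Plane → ℝ} {dt : ℝ} (hdt : 0 < dt) {s : T → ℝ} {c : ℝ} (hs : ∀ K, 0 < s K)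
    (hc : ∀ K, Real.log (s K) + V (M.center K) = c)
    (huD : ∀ σ ∈ M.dirichletEdges ΓD, 0 < uD (M.edgeCenter σ))
    (hD : ∀ σ ∈ M.dirichletEdges ΓD, Real.log (uD (M.edgeCenter σ)) + V (M.edgeCenter σ) = c)
    {A B : ℝ} (hA : 0 < A) (hA1 : A ≤ 1) (hB1 : 1 ≤ B)
    (h0 : ∀ K, s K * A ≤ M.initialValue u₀ K ∧ M.initialValue u₀ K ≤ s K * B) :
    ∃ u : ℕ → M.DiscreteVector ΓD, IsSolution r V uD u₀ dt u ∧
      ∀ n K, s K * A ≤ (u n).1 K ∧ (u n).1 K ≤ s K * B := by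
  choose step hbd hdir hbal using fun p : {p : T → ℝ // ∀ K, s K * A ≤ p K ∧ p K ≤ s K * B} =>
    exists_time_step (M := M) (ΓD := ΓD) hr hdt hs hc huD hD hA hA1 hB1 p.2
  let q : ℕ → {u : M.DiscreteVector ΓD // ∀ K, s K * A ≤ u.1 K ∧ u.1 K ≤ s K * B} := fun n =>
    Nat.rec ⟨(M.initialValue u₀, fun σ => uD (M.edgeCenter σ)), h0⟩
      (fun _ u => ⟨step ⟨u.1.1, u.2⟩, hbd _⟩) n
  exact ⟨fun n => (q n).1,
    { pos := fun n K => (mul_pos (hs K) hA).trans_le ((q n).2 K).1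
      initial := fun K => rfl
      dirichlet := fun n σ => hdir _ σ
      balance := fun n K => hbal _ K }, fun n => (q n).2⟩

theorem IsAdmissible.nonempty {Ω ΓN : Set Plane} (hM : M.IsAdmissible Ω ΓD ΓN)
    (hΩ : Ω.Nonempty) : Nonempty T := by
  by_contra h
  rw [not_nonempty_iff] at h
  have h1 := hM.closure_iUnion_cell
  rw [iUnion_of_empty, closure_empty] at h1
  exact hΩ.closure.ne_empty h1.symm

/-- The steady state has the form `exp (c - V_K)`, with `c` given by the Dirichlet data if there are
any. The point is that `ρ > 0` without Dirichlet edges, where it is a quotient of positive numbers. -/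
theorem IsAdmissible.exists_steadyState_eq [Fintype T] {Ω ΓN : Set Plane}
    (hM : M.IsAdmissible Ω ΓD ΓN) (hΩ : IsPolygonalDomain Ω) {V u₀ : Plane → ℝ}
    (hu₀ : MemLp u₀ 2 (volume.restrict Ω)) (hu₀_nonneg : ∀ᵐ x ∂volume.restrict Ω, 0 ≤ u₀ x)
    (hpos : ∀ K, 0 < M.initialValue u₀ K) (αD : ℝ) :
    ∃ c : ℝ, (∀ K, M.steadyState ΓD Ω V u₀ αD K = Real.exp (c - V (M.center K))) ∧
      ((M.dirichletEdges ΓD).Nonempty → c = αD) := by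
  by_cases hD : (M.dirichletEdges ΓD).Nonempty
  · refine ⟨αD, fun K => ?_, fun _ => rfl⟩
    rw [steadyState, if_pos hD, ← Real.exp_add, sub_eq_add_neg]
  obtain ⟨K₀⟩ := hM.nonempty hΩ.isConnected.nonempty
  have hfin : volume Ω ≠ ⊤ := hΩ.isBounded.measure_lt_top.ne
  have : IsFiniteMeasure (volume.restrict Ω) := ⟨by simpa using hfin.lt_top⟩
  have hm0 : ∀ K, 0 ≤ M.cellMeasure K := fun K => ENNReal.toReal_nonneg
  -- A cell of measure zero would have the junk initial value `1 / 0 * _ = 0`.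
  have hm : ∀ K, 0 < M.cellMeasure K := fun K => by
    refine (hm0 K).lt_of_ne fun h => ?_
    have := hpos K
    rw [initialValue, ← h] at this
    simp at this
  have hint : 0 < ∫ x in Ω, u₀ x := by
    have h1 : 0 < ∫ x in M.cell K₀, u₀ x :=
      pos_of_mul_pos_right (hpos K₀) (one_div_nonneg.2 (hm0 K₀))
    exact h1.trans_le (setIntegral_mono_set (hu₀.integrable (by norm_num)) hu₀_nonneg
      (hM.cell_subset K₀).eventuallyLE)
  have hsum : 0 < ∑ L, M.cellMeasure L * Real.exp (-V (M.center L)) :=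
    Finset.sum_pos (fun L _ => mul_pos (hm L) (Real.exp_pos _)) ⟨K₀, Finset.mem_univ _⟩
  refine ⟨Real.log ((∫ x in Ω, u₀ x) / ∑ L, M.cellMeasure L * Real.exp (-V (M.center L))),
    fun K => ?_, fun h => absurd h hD⟩
  rw [steadyState, if_neg hD, sub_eq_add_neg, Real.exp_add, Real.exp_log (div_pos hint hsum)]

end MeshData

end TPFA

theorem proposition2p3 {T E : Type*} [Fintype T]
    (Ω ΓD ΓN : Set TPFA.Plane) (hΩ : TPFA.IsPolygonalDomain Ω)
    (hΓ : ΓD ∪ ΓN = frontier Ω) (hΓdisj : Disjoint ΓD ΓN)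
    (M : TPFA.MeshData T E) (hM : M.IsAdmissible Ω ΓD ΓN)
    (V : TPFA.Plane → ℝ) (hV : TPFA.IsC1OnClosure Ω V)
    (u₀ : TPFA.Plane → ℝ) (hu₀ : MeasureTheory.MemLp u₀ 2 (MeasureTheory.volume.restrict Ω))
    (hu₀_nonneg : ∀ᵐ x ∂(MeasureTheory.volume.restrict Ω), 0 ≤ u₀ x)
    (m₀ : ℝ) (hm₀ : 0 < m₀) (hu₀_lower : ∀ K, m₀ ≤ M.initialValue u₀ K)
    (uD : TPFA.Plane → ℝ) (huD : ∀ x ∈ ΓD, 0 < uD x)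
    (αD : ℝ)
    (hbc : M.dirichletEdges ΓD = ∅ ∨
      ((M.dirichletEdges ΓD).Nonempty ∧
        ∀ σ ∈ M.dirichletEdges ΓD,
          Real.log (uD (M.edgeCenter σ)) + V (M.edgeCenter σ) = αD))
    (r : ℝ → ℝ → ℝ) (hr : TPFA.IsMeanFunction r)
    (dt : ℝ) (hdt : 0 < dt) :
    ∃ u : ℕ → M.DiscreteVector ΓD,
      TPFA.MeshData.IsSolution r V uD u₀ dt u ∧
      ∀ mInf MInf : ℝ, 0 < mInf → 0 < MInf →
        (∀ K, mInf ≤ M.steadyState ΓD Ω V u₀ αD K ∧ M.steadyState ΓD Ω V u₀ αD K ≤ MInf) →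
        ∀ n K,
          mInf * min 1 (⨅ L, M.initialValue u₀ L / M.steadyState ΓD Ω V u₀ αD L) ≤ (u n).1 K ∧
          (u n).1 K ≤
            MInf * max 1 (⨆ L, M.initialValue u₀ L / M.steadyState ΓD Ω V u₀ αD L) := by
  have hpos : ∀ K, 0 < M.initialValue u₀ K := fun K => hm₀.trans_le (hu₀_lower K)
  have : Nonempty T := hM.nonempty hΩ.isConnected.nonempty
  obtain ⟨c, hc, hcD⟩ := hM.exists_steadyState_eq hΩ (V := V) hu₀ hu₀_nonneg hpos αD
  set s := M.steadyState ΓD Ω V u₀ αD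
  have hs : ∀ K, 0 < s K := fun K => hc K ▸ Real.exp_pos _
  set A := min 1 (⨅ L, M.initialValue u₀ L / s L)
  set B := max 1 (⨆ L, M.initialValue u₀ L / s L)
  have hA : 0 < A := by
    obtain ⟨L, hL⟩ := exists_eq_ciInf_of_finite (f := fun L => M.initialValue u₀ L / s L)
    exact lt_min one_pos (hL ▸ div_pos (hpos L) (hs L))
  have hB : 0 < B := lt_max_of_lt_left one_pos
  obtain ⟨u, hu, hbd⟩ := TPFA.MeshData.exists_isSolution_of_bounds (M := M) (ΓD := ΓD) (V := V)
    (uD := uD) (u₀ := u₀) (A := A) (B := B) hr hdt hs (c := c)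
    (fun K => by rw [hc K, Real.log_exp, sub_add_cancel])
    (fun σ hσ => huD _ (hσ (M.edgeCenter_mem_edge σ)))
    (fun σ hσ => by
      rcases hbc with h | ⟨hne, h⟩
      · exact absurd hσ (h ▸ Set.notMem_empty σ)
      · rw [h σ hσ, hcD hne])
    hA (min_le_left _ _) (le_max_left _ _)
    (fun K => by
      rw [← le_div_iff₀' (hs K), ← div_le_iff₀' (hs K)]
      exact ⟨(min_le_right _ _).trans (ciInf_le (Set.finite_range _).bddBelow K),
        (le_ciSup (f := fun L => M.initialValue u₀ L / s L)
          (Set.finite_range _).bddAbove K).trans (le_max_right _ _)⟩)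
  exact ⟨u, hu, fun mInf MInf _ _ hb n K =>
    ⟨(mul_le_mul_of_nonneg_right (hb K).1 hA.le).trans (hbd n K).1,
      (hbd n K).2.trans (mul_le_mul_of_nonneg_right (hb K).2 hB.le)⟩⟩
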